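/- Let $\beta\ge 1$ be an integer, $\alpha=2^\beta$, $n$ an integer, and $q$ a prime power such that $\frac{\alpha}{2}\mid q-1$. Let $b_1,\dots,b_\beta\in\mathbb{F}_{q^\alpha}$ satisfy $\mathbb{F}_{q^{\alpha/2^{i-1}}}=\mathbb{F}_{q^{\alpha/2^{i}}}(b_i)$ for all $1\le i\le\beta$, and let $$\boldsymbol{\omega}=(\omega_1,\dots,\omega_\alpha)=(1,b_1)\otimes(1,b_2)\otimes\cdots\otimes(1,b_\beta)$$ (Kronecker product); equivalently $\boldsymbol\omega=W_\beta$, where $W_0=(1)$ and $W_{i+1}$ is the concatenation of $W_i$ and $b_{\beta-i}W_i$. Let $\nu_1,\dots,\nu_n\in\mathbb{F}_q$ be nonzero with $\nu_j^{\alpha/2}\ne\nu_k^{\alpha/2}$ for all $j\ne k$, and let $V=(\nu_j^{r-1})_{1\le r\le\alpha,\,1\le j\le n}$ be the $\alpha\times n$ Vandermonde matrix. For a matrix $M$ with an even number of rows let $\mathrm{UH}(M)$ and $\mathrm{LH}(M)$ be its upper and lower half. Put $M_0=V$ and $M_i=\mathrm{UH}(M_{i-1})+b_i\,\mathrm{LH}(M_{i-1})$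 for $1\le i\le\beta$, and let $\mathbf h=(h_1,\dots,h_n)=M_\beta=\mathcal H^{(\beta)}(V)$, a row vector over $\mathbb{F}_{q^\alpha}$. Let $\mathcal C=\ker(\mathbf h)=\{\mathbf c\in\mathbb{F}_{q^\alpha}^n : \mathbf h\mathbf c^{\mathsf T}=0\}$. A power erasure pattern is a tuple $\mathbf t=(t_1,\dots,t_n)$ for which there are a set $J\subseteq\{1,\dots,n\}$ and integers $0\le m_j\le\beta$ $(j\in J)$ with $\sum_{j\in J}2^{-m_j}=1$, such that $t_j=\alpha/2^{m_j}$ for $j\in J$ and $t_j=0$ for $j\notin J$. Then $\boldsymbol\omega$ is a basis of $\mathbb{F}_{q^\alpha}$ over $\mathbb{F}_q$, and $\mathcal C$ corrects every power erasure pattern over $\boldsymbol\omega$: for every power erasure pattern $\mathbf t$, a codeword $\mathbf c=(c_1,\dots,c_n)\in\mathcal C$ is uniquely determined by what remains after erasing, for each $j$, the first $t_j$ of the coordinates $c_{j,1},\dots,c_{j,\alpha}$ of $c_j=\sum_{i=1}^{\alpha}c_{j,i}\omega_i$. -/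

import Mathlib

/-- The vector `b = (b_1, …, b_β)` of elements of `L = 𝔽_{q^α}`, `α = 2 ^ β`, generates the tower of
subfields step by step: with `E i` the subfield `𝔽_{q^{α/2^i}}`, i.e. the intermediate field of
degree `α / 2 ^ i` over `K = 𝔽_q`, one has `𝔽_{q^{α/2^{i-1}}} = 𝔽_{q^{α/2^i}}(b_i)` for
`1 ≤ i ≤ β`.  (The entry `b_i` is `b (i - 1)` in the code, indices start at `0`.) -/
def IsTowerGenerating (K : Type*) {L : Type*} [Field K] [Field L] [Algebra K L] (β : ℕ)
    (b : Fin β → L) : Prop :=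
  ∃ E : ℕ → IntermediateField K L,
    (∀ i ≤ β, Module.finrank K (E i) = 2 ^ β / 2 ^ i) ∧
    ∀ i : Fin β, E i =
      (IntermediateField.adjoin (E ((i : ℕ) + 1)) {b i}).restrictScalars K

/-- The vector `(1, b_1) ⊗ (1, b_2) ⊗ ⋯ ⊗ (1, b_k)`, by the recursion
`W(b_1, …, b_k) = W(b_2, …, b_k) | b_1 · W(b_2, …, b_k)`, where `|` is concatenation. -/
def recursiveVector {L : Type*} [Field L] : (k : ℕ) → (Fin k → L) → Fin (2 ^ k) → L
  | 0, _ => fun _ => 1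
  | k + 1, b => fun j =>
      Fin.append (recursiveVector k (Fin.tail b)) (b 0 • recursiveVector k (Fin.tail b))
        (Fin.cast (by rw [pow_succ, mul_two]) j)

/-- The first `2 ^ k` rows of a matrix with `2 ^ (k + 1)` rows. -/
def upperHalf {L : Type*} {k n : ℕ} (M : Matrix (Fin (2 ^ (k + 1))) (Fin n) L) :
    Matrix (Fin (2 ^ k)) (Fin n) L :=
  fun r j => M ⟨r, by have := r.isLt; rw [pow_succ]; omega⟩ j

/-- The last `2 ^ k` rows of a matrix with `2 ^ (k + 1)` rows. -/
def lowerHalf {L : Type*} {k n : ℕ} (M : Matrix (Fin (2 ^ (k + 1))) (Fin n) L) :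
    Matrix (Fin (2 ^ k)) (Fin n) L :=
  fun r j => M ⟨2 ^ k + r, by have := r.isLt; rw [pow_succ]; omega⟩ j

/-- Half-folding with coefficient `x`: `UH(M) + x · LH(M)`. -/
def halfFold {L : Type*} [Field L] {k n : ℕ} (x : L)
    (M : Matrix (Fin (2 ^ (k + 1))) (Fin n) L) : Matrix (Fin (2 ^ k)) (Fin n) L :=
  upperHalf M + x • lowerHalf M

/-- Iterated half-folding of a matrix with `2 ^ k` rows down to a single row, with the
coefficients `b_1, b_2, …, b_k` in this order: `b_1` goes with the first fold, of the full matrix,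
and `b_k` with the last one. -/
def iteratedFold {L : Type*} [Field L] {n : ℕ} :
    (k : ℕ) → (Fin k → L) → Matrix (Fin (2 ^ k)) (Fin n) L → Matrix (Fin 1) (Fin n) L
  | 0, _, M => M
  | k + 1, b, M => iteratedFold k (Fin.tail b) (halfFold (b 0) M)

/-- The `a × n` Vandermonde matrix defined by `ν`, with `(r, j)` entry `ν_j ^ r`, `0 ≤ r < a`. -/
def vandermondeMatrix {K : Type*} [Field K] {n : ℕ} (a : ℕ) (ν : Fin n → K) :
    Matrix (Fin a) (Fin n) K :=
  fun r j => ν j ^ (r : ℕ)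

/-- The code `ker(h) = {c ∈ L ^ n | h cᵀ = 0}` for the row vector `h = (h_1, …, h_n)` that iterated
half-folding makes of the `2 ^ β × n` Vandermonde matrix on `ν_1, …, ν_n ∈ K`. -/
noncomputable def foldedCode {K L : Type*} [Field K] [Field L] [Algebra K L] {n : ℕ} (β : ℕ)
    (b : Fin β → L) (ν : Fin n → K) : Submodule L (Fin n → L) :=
  LinearMap.ker
    (iteratedFold β b ((vandermondeMatrix (2 ^ β) ν).map (algebraMap K L))).mulVecLin

/-- Erasure patterns: `(t_1, …, t_n)` with `0 ≤ t_j ≤ α` and `∑ t_j ≤ α`. -/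
def erasurePatterns (α n : ℕ) : Set (Fin n → ℕ) :=
  {t | (∀ j, t j ≤ α) ∧ ∑ j, t j ≤ α}

/-- Power erasure patterns, for `α = 2 ^ β`. -/
def powerErasurePatterns (β n : ℕ) : Set (Fin n → ℕ) :=
  {t | t ∈ erasurePatterns (2 ^ β) n ∧
    ∃ (J : Finset (Fin n)) (m : Fin n → ℕ),
      (∀ j ∈ J, m j ≤ β) ∧ ∑ j ∈ J, (1 / 2 : ℚ) ^ m j = 1 ∧
      ∀ j, t j = if j ∈ J then 2 ^ β / 2 ^ m j else 0}

/-- The code `C` corrects every erasure pattern in `T` over the ordered basis `ω`: for `t ∈ T`, a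
codeword `c` is determined by what remains of it when, for each `i`, the first `t_i` of the
coordinates of the symbol `c_i` over `ω` are erased. -/
def IsCorrecting {K L : Type*} [Field K] [Field L] [Algebra K L] {α n : ℕ}
    (ω : Module.Basis (Fin α) K L) (T : Set (Fin n → ℕ)) (C : Submodule L (Fin n → L)) : Prop :=
  ∀ t ∈ T, ∀ c ∈ C, ∀ c' ∈ C,
    (∀ (i : Fin n) (j : Fin α), t i ≤ (j : ℕ) → ω.repr (c i) j = ω.repr (c' i) j) → c = c'

/-! Write `w r` for `towerMonomial b r`; then `h_j = ∑ w r * ν_j ^ r`. Let `D` be the difference of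
two codewords that agree off the erasures, and `N_j = 2 ^ (β - m j)`. Then `D j` lies in the span of
the first `N_j` monomials, which is a subfield (`span_towerMonomial_eq`). Splitting `r = N_j * h +
s` factors `h_j` as `high_j * low_j` with `low_j` a nonzero element of that subfield, so `d_j =
low_j * D j` stays in it and the parity check reads `∑ high_j * d_j = 0`.

The coordinates of the `d_j` are separated by linear functionals `w r ↦ f.coeff r`. On `high_j * w
s` such a functional gives `∑ y_j ^ h * f.coeff (N_j * h + s)` with `y_j = ν_j ^ N_j`, the
coefficient of `X ^ s` in `f` modulo `X ^ N_j - y_j`. As these moduli are pairwise coprime of total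
degree `2 ^ β`, the Chinese remainder theorem prescribes all residues (`exists_dual_polynomial`), so
every `d_j` vanishes. -/

/-! ### Residues modulo binomials -/

open Polynomial in
-- The sum is the coefficient of `X ^ s` in the remainder modulo `X ^ N - y`, and a multiple of the
-- modulus has remainder zero.
theorem sum_pow_mul_coeff_X_pow_sub_C_mul {K : Type*} [Field K] {N H s : ℕ} (hs : s < N) (y : K)
    (g : K[X]) (hdeg : ((X ^ N - C y) * g).natDegree < N * H) :
    ∑ h ∈ Finset.range H, y ^ h * ((X ^ N - C y) * g).coeff (N * h + s) = 0 := by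
  have hN : 0 < N := by omega
  -- The sum telescopes to `u 0 - u H`; `u 0` is zero by definition, `u H` by the degree bound.
  let u : ℕ → K := fun h => if h = 0 then 0 else y ^ h * g.coeff (N * (h - 1) + s)
  have hterm : ∀ h, y ^ h * ((X ^ N - C y) * g).coeff (N * h + s) = u h - u (h + 1) := by
    intro h
    rw [sub_mul, coeff_sub, coeff_C_mul, coeff_X_pow_mul']
    rcases h with _ | h
    · simp [u, not_le.mpr hs]
    · have h1 : N ≤ N * (h + 1) + s := by rw [mul_add]; omega
      have h2 : N * (h + 1) + s - N = N * h + s := by rw [mul_add]; omega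
      simp only [u, h1, h2, if_true, Nat.add_sub_cancel, Nat.succ_ne_zero, if_false]
      ring
  rw [Finset.sum_congr rfl fun h _ => hterm h, Finset.sum_range_sub']
  rcases H with _ | H
  · simp
  · by_cases hg : g = 0
    · simp [u, hg]
    · rw [(monic_X_pow_sub_C y hN.ne').natDegree_mul' hg, natDegree_X_pow_sub_C, mul_add,
        mul_one] at hdeg
      simp [u, coeff_eq_zero_of_natDegree_lt (show g.natDegree < N * H + s by omega)]

open Polynomial in
theorem isCoprime_X_pow_sub_C_of_ne {K : Type*} [Field K] (N : ℕ) {u v : K} (h : u ≠ v) :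
    IsCoprime (X ^ N - C u : K[X]) (X ^ N - C v) := by
  refine ⟨C (v - u)⁻¹, -C (v - u)⁻¹, ?_⟩
  have : C (v - u)⁻¹ * (X ^ N - C u) + -C (v - u)⁻¹ * (X ^ N - C v) =
      C (v - u)⁻¹ * C (v - u) := by rw [C_sub]; ring
  rw [this, ← C_mul, inv_mul_cancel₀ (sub_ne_zero.mpr h.symm), C_1]

open Polynomial in
-- `X ^ N - x ^ N` divides `X ^ M - x ^ M`, so comparing the powers of larger exponent suffices.
theorem isCoprime_X_pow_sub_C_pow {K : Type*} [Field K] {N M : ℕ} (hNM : N ∣ M) {x y : K}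
    (h : x ^ M ≠ y ^ M) :
    IsCoprime (X ^ N - C (x ^ N) : K[X]) (X ^ M - C (y ^ M)) := by
  refine IsCoprime.of_isCoprime_of_dvd_left (isCoprime_X_pow_sub_C_of_ne M h) ?_
  obtain ⟨k, rfl⟩ := hNM
  have h1 := sub_dvd_pow_sub_pow (X ^ N : K[X]) (C (x ^ N)) k
  rwa [← pow_mul, ← C_pow, ← pow_mul] at h1

open Polynomial in
theorem exists_dual_polynomial {K ι : Type*} [Field K] [DecidableEq ι] (J : Finset ι)
    (N : ι → ℕ) (y : ι → K)
    (hco : ∀ i ∈ J, ∀ j ∈ J, i ≠ j →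
      IsCoprime (X ^ N i - C (y i) : K[X]) (X ^ N j - C (y j)))
    {i : ι} (hi : i ∈ J) {s₀ : ℕ} (hs₀ : s₀ < N i) :
    ∃ f : K[X], ∀ j ∈ J, ∀ s < N j, ∀ H, N j * H = ∑ k ∈ J, N k →
      ∑ h ∈ Finset.range H, y j ^ h * f.coeff (N j * h + s) =
        if j = i ∧ s = s₀ then 1 else 0 := by
  have hNi : N i ≠ 0 := by omega
  set P : ι → K[X] := fun j => X ^ N j - C (y j) with hP
  set Q : K[X] := ∏ j ∈ J.erase i, P j with hQ
  have hmonic := monic_X_pow_sub_C (y i) hNi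
  have hPQ : IsCoprime (P i) Q := IsCoprime.prod_right fun j hj =>
    hco i hi j (Finset.mem_of_mem_erase hj) (Finset.ne_of_mem_erase hj).symm
  obtain ⟨u, v, huv⟩ := hPQ
  -- `v` inverts `Q` modulo `P i`, so `Q * g` is `X ^ s₀` modulo `P i` and zero modulo the other `P
  -- j`. Reducing modulo `P i` keeps the degree below `∑ N k`.
  set g : K[X] := (X ^ s₀ * v) %ₘ P i with hg
  have hgdeg : g.natDegree < N i := by
    have := natDegree_modByMonic_lt (X ^ s₀ * v) hmonic (by
      intro h1
      have := congrArg natDegree h1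
      rw [natDegree_X_pow_sub_C, natDegree_one] at this
      exact hNi this)
    rwa [natDegree_X_pow_sub_C] at this
  have hdeg : (Q * g).natDegree < ∑ k ∈ J, N k := by
    refine natDegree_mul_le.trans_lt ?_
    rw [← Finset.sum_erase_add _ _ hi]
    refine add_lt_add_of_le_of_lt ((natDegree_prod_le _ _).trans ?_) hgdeg
    exact Finset.sum_le_sum fun j _ => (natDegree_X_pow_sub_C).le
  refine ⟨Q * g, fun j hj s hs H hH => ?_⟩
  by_cases hji : j = i
  · subst hji
    have hH0 : 0 < H := by
      rcases Nat.eq_zero_or_pos H with rfl | h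
      · rw [← hH] at hdeg; simp at hdeg
      · exact h
    obtain ⟨e, he⟩ : P j ∣ Q * g - X ^ s₀ := by
      have h1 := modByMonic_add_div (X ^ s₀ * v) (P j)
      refine ⟨-(Q * ((X ^ s₀ * v) /ₘ P j)) - X ^ s₀ * u, ?_⟩
      rw [hg]
      linear_combination Q * h1 + X ^ s₀ * huv
    have hf : Q * g = X ^ s₀ + P j * e := by rw [← he]; ring
    have hs₀H : s₀ < N j * H := hs₀.trans_le (Nat.le_mul_of_pos_right _ hH0)
    have hed : (P j * e).natDegree < N j * H := by
      rw [← he]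
      refine (natDegree_sub_le _ _).trans_lt (max_lt (hH ▸ hdeg) ?_)
      rwa [natDegree_X_pow]
    simp only [hf, coeff_add, mul_add, Finset.sum_add_distrib]
    rw [sum_pow_mul_coeff_X_pow_sub_C_mul hs (y j) e hed, add_zero,
      Finset.sum_eq_single_of_mem 0 (Finset.mem_range.mpr hH0)]
    · simp [coeff_X_pow]
    · intro h _ hh
      have : N j ≤ N j * h := Nat.le_mul_of_pos_right _ (Nat.pos_of_ne_zero hh)
      rw [coeff_X_pow, if_neg (by omega), mul_zero]
  · obtain ⟨e, he⟩ : P j ∣ Q * g :=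
      (Finset.dvd_prod_of_mem P (Finset.mem_erase.mpr ⟨hji, hj⟩)).mul_right g
    rw [if_neg (fun h => hji h.1), he]
    rw [he, ← hH] at hdeg
    exact sum_pow_mul_coeff_X_pow_sub_C_mul hs (y j) e hdeg

/-! ### Tower monomials and folding -/

/-- The product of those `b i` for which the binary digit of `r` in position `β - 1 - i` is `1`. -/
def towerMonomial {L : Type*} [Field L] {β : ℕ} (b : Fin β → L) (r : ℕ) : L :=
  ∏ i : Fin β, if r.testBit (β - (i + 1)) then b i else 1

theorem towerMonomial_zero {L : Type*} [Field L] {β : ℕ} (b : Fin β → L) :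
    towerMonomial b 0 = 1 := by
  simp [towerMonomial]

theorem towerMonomial_succ {L : Type*} [Field L] {k : ℕ} (b : Fin (k + 1) → L) (r : ℕ) :
    towerMonomial b r = (if r.testBit k then b 0 else 1) * towerMonomial (Fin.tail b) r := by
  rw [towerMonomial, Fin.prod_univ_succ]
  simp [towerMonomial, Fin.tail]

/-- The binary digits of `2 ^ a * h` and of `s` occupy disjoint positions. -/
theorem towerMonomial_two_pow_mul_add {L : Type*} [Field L] {β : ℕ} (b : Fin β → L) {a s : ℕ}
    (h : ℕ) (hs : s < 2 ^ a) :
    towerMonomial b (2 ^ a * h + s) = towerMonomial b (2 ^ a * h) * towerMonomial b s := by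
  simp only [towerMonomial, ← Finset.prod_mul_distrib]
  refine Finset.prod_congr rfl fun i _ => ?_
  have h0 := Nat.testBit_two_pow_mul_add h (Nat.two_pow_pos a) (β - (i + 1))
  rw [Nat.testBit_two_pow_mul_add h hs, add_zero] at *
  rw [h0]
  by_cases h1 : β - (i + 1) < a
  · simp [h1]
  · rw [Nat.testBit_lt_two_pow (hs.trans_le (Nat.pow_le_pow_right two_pos (not_lt.mp h1)))]
    simp [h1]

theorem towerMonomial_tail_of_lt {L : Type*} [Field L] {k : ℕ} (b : Fin (k + 1) → L) {r : ℕ}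
    (hr : r < 2 ^ k) : towerMonomial b r = towerMonomial (Fin.tail b) r := by
  rw [towerMonomial_succ, Nat.testBit_lt_two_pow hr]
  simp

theorem towerMonomial_two_pow {L : Type*} [Field L] {β : ℕ} (b : Fin β → L) (i : Fin β) :
    towerMonomial b (2 ^ (β - (i + 1) : ℕ)) = b i := by
  rw [towerMonomial, Finset.prod_eq_single i]
  · simp
  · intro j _ hj
    rw [Nat.testBit_two_pow_of_ne, if_neg (by simp)]
    intro h
    exact hj (Fin.ext (by omega))
  · simp

theorem towerMonomial_two_pow_add {L : Type*} [Field L] {k : ℕ} (b : Fin (k + 1) → L) {r : ℕ}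
    (hr : r < 2 ^ k) : towerMonomial b (2 ^ k + r) = b 0 * towerMonomial (Fin.tail b) r := by
  have h := towerMonomial_two_pow_mul_add b 1 hr
  have h2 := towerMonomial_two_pow b 0
  simp only [Fin.val_zero, zero_add, Nat.add_sub_cancel] at h2
  rw [mul_one] at h
  rw [h, h2, towerMonomial_tail_of_lt b hr]

theorem recursiveVector_apply {L : Type*} [Field L] {k : ℕ} (b : Fin k → L) (r : Fin (2 ^ k)) :
    recursiveVector k b r = towerMonomial b r := by
  induction k with
  | zero => simp [recursiveVector, towerMonomial]
  | succ k ih =>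
    have hk : 2 ^ (k + 1) = 2 ^ k + 2 ^ k := by rw [pow_succ, mul_two]
    obtain ⟨r, rfl⟩ : ∃ r' : Fin (2 ^ k + 2 ^ k), r = Fin.cast hk.symm r' := ⟨Fin.cast hk r, rfl⟩
    rw [recursiveVector]
    simp only [Fin.cast_cast, Fin.cast_eq_self, Fin.val_cast]
    refine Fin.addCases (fun s => ?_) (fun s => ?_) r
    · rw [Fin.append_left, ih, Fin.val_castAdd, towerMonomial_tail_of_lt b s.isLt]
    · rw [Fin.append_right, Pi.smul_apply, ih, Fin.val_natAdd,
        towerMonomial_two_pow_add b s.isLt, smul_eq_mul]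

/-- Indexing the rows by `ℕ` makes the lower half a shift of `f`, so the induction needs no casts.
-/
theorem iteratedFold_apply {L : Type*} [Field L] {n k : ℕ} (b : Fin k → L)
    (f : ℕ → Fin n → L) (j : Fin n) :
    iteratedFold k b (fun r : Fin (2 ^ k) => f r) 0 j =
      ∑ r ∈ Finset.range (2 ^ k), towerMonomial b r * f r j := by
  induction k generalizing f with
  | zero => simp [iteratedFold, towerMonomial]
  | succ k ih =>
    refine (ih (Fin.tail b) fun r j => f r j + b 0 * f (2 ^ k + r) j).trans ?_
    rw [pow_succ, mul_two, Finset.sum_range_add, ← Finset.sum_add_distrib]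
    refine Finset.sum_congr rfl fun r hr => ?_
    rw [towerMonomial_two_pow_add b (Finset.mem_range.mp hr),
      towerMonomial_tail_of_lt b (Finset.mem_range.mp hr)]
    ring

theorem sum_range_mul_eq_sum_sum {M : Type*} [AddCommMonoid M] (N H : ℕ) (f : ℕ → M) :
    ∑ r ∈ Finset.range (N * H), f r =
      ∑ h ∈ Finset.range H, ∑ s ∈ Finset.range N, f (N * h + s) := by
  induction H with
  | zero => simp
  | succ H ih => rw [mul_add, mul_one, Finset.sum_range_add, ih, Finset.sum_range_succ]

theorem mem_foldedCode_iff {K L : Type*} [Field K] [Field L] [Algebra K L] {n β : ℕ}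
    (b : Fin β → L) (ν : Fin n → K) (c : Fin n → L) :
    c ∈ foldedCode β b ν ↔ ∑ j, (∑ r ∈ Finset.range (2 ^ β),
      towerMonomial b r * algebraMap K L (ν j) ^ r) * c j = 0 := by
  have h : (vandermondeMatrix (2 ^ β) ν).map (algebraMap K L) =
      fun r : Fin (2 ^ β) => (fun (r : ℕ) j => algebraMap K L (ν j) ^ r) r := by
    ext r j
    simp [vandermondeMatrix]
  rw [foldedCode, LinearMap.mem_ker, h, funext_iff, Fin.forall_fin_one]
  simp only [Matrix.mulVecLin_apply, Matrix.mulVec, dotProduct, Pi.zero_apply]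
  simp only [iteratedFold_apply b (fun r j => algebraMap K L (ν j) ^ r)]

/-! ### The tower of subfields and its basis -/

/-- Adjoining `x` to `F` with twice the degree gives `F + x F`. -/
theorem IntermediateField.toSubmodule_eq_sup_map_of_finrank_eq_two_mul {K L : Type*} [Field K]
    [Field L] [Algebra K L] [FiniteDimensional K L] {F E : IntermediateField K L} {x : L}
    (hE : E = (IntermediateField.adjoin F {x}).restrictScalars K)
    (hdeg : Module.finrank K E = 2 * Module.finrank K F) :
    Subalgebra.toSubmodule E.toSubalgebra = Subalgebra.toSubmodule F.toSubalgebra ⊔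
      (Subalgebra.toSubmodule F.toSubalgebra).map (LinearMap.mulLeft K x) := by
  have hFpos : 0 < Module.finrank K F := Module.finrank_pos
  have hFE : F ≤ E := by
    intro z hz
    rw [hE]
    exact (IntermediateField.adjoin F {x}).algebraMap_mem ⟨z, hz⟩
  have hxE : x ∈ E := by
    rw [hE]
    exact IntermediateField.mem_adjoin_simple_self F x
  have hxF : x ∉ F := by
    intro hx
    have h1 : IntermediateField.adjoin F {x} = ⊥ :=
      IntermediateField.adjoin_simple_eq_bot_iff.mpr
        (IntermediateField.mem_bot.mpr ⟨⟨x, hx⟩, rfl⟩)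
    have h2 : E ≤ F := by
      intro z hz
      rw [hE, h1, IntermediateField.mem_restrictScalars] at hz
      obtain ⟨w, rfl⟩ := IntermediateField.mem_bot.mp hz
      exact w.2
    have h3 : E = F := le_antisymm h2 hFE
    rw [h3] at hdeg
    omega
  have hx0 : x ≠ 0 := fun h => hxF (h ▸ F.zero_mem)
  symm
  refine Submodule.eq_of_le_of_finrank_eq ?_ ?_
  · refine sup_le hFE ?_
    rintro _ ⟨z, hz, rfl⟩
    exact E.mul_mem hxE (hFE hz)
  -- A nonzero `x * v` in `F` with `v` in `F` would put `x` in `F`; hence the sum is direct and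
  -- dimensions add up.
  · have hdisj : Subalgebra.toSubmodule F.toSubalgebra ⊓
        (Subalgebra.toSubmodule F.toSubalgebra).map (LinearMap.mulLeft K x) = ⊥ := by
      rw [eq_bot_iff]
      rintro _ ⟨hz, ⟨v, hv, rfl⟩⟩
      rw [LinearMap.mulLeft_apply] at hz ⊢
      by_cases hv0 : v = 0
      · simp [hv0]
      · refine absurd ?_ hxF
        have : x * v * v⁻¹ ∈ F := F.mul_mem hz (F.inv_mem hv)
        rwa [mul_inv_cancel_right₀ hv0] at this
    have h := Submodule.finrank_sup_add_finrank_inf_eq (Subalgebra.toSubmodule F.toSubalgebra)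
      ((Subalgebra.toSubmodule F.toSubalgebra).map (LinearMap.mulLeft K x))
    rw [hdisj, finrank_bot, add_zero,
      ← (Submodule.equivMapOfInjective (LinearMap.mulLeft K x) (mul_right_injective₀ hx0)
        (Subalgebra.toSubmodule F.toSubalgebra)).finrank_eq] at h
    rw [h, ← two_mul]
    exact hdeg.symm

/-- If `b` generates the tower `E`, the first `2 ^ a` monomials in `b` span the field of the tower
that has degree `2 ^ a`. -/
theorem span_towerMonomial_eq {K L : Type*} [Field K] [Field L] [Algebra K L]
    [FiniteDimensional K L] {β : ℕ} {b : Fin β → L} {E : ℕ → IntermediateField K L}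
    (hE : ∀ i ≤ β, Module.finrank K (E i) = 2 ^ β / 2 ^ i)
    (hb : ∀ i : Fin β, E i =
      (IntermediateField.adjoin (E ((i : ℕ) + 1)) {b i}).restrictScalars K) {a : ℕ} (ha : a ≤ β) :
    Submodule.span K (towerMonomial b '' Set.Iio (2 ^ a)) =
      Subalgebra.toSubmodule (E (β - a)).toSubalgebra := by
  induction a with
  | zero =>
    have h1 : E β = ⊥ := by
      rw [← IntermediateField.finrank_eq_one_iff, hE β le_rfl, Nat.div_self (Nat.two_pow_pos β)]
    have h2 : Set.Iio (2 ^ 0) = {0} := by ext; simp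
    rw [Nat.sub_zero, h1, h2, Set.image_singleton, towerMonomial_zero,
      IntermediateField.bot_toSubalgebra, Algebra.toSubmodule_bot, Submodule.one_eq_span]
  | succ a ih =>
    have hlt : β - (a + 1) < β := by omega
    have hsub : β - (a + 1) + 1 = β - a := by omega
    have hbi := hb ⟨β - (a + 1), hlt⟩
    simp only at hbi
    have hw := towerMonomial_two_pow b ⟨β - (a + 1), hlt⟩
    simp only [hsub, show β - (β - a) = a by omega] at hw
    have hdeg : Module.finrank K (E (β - (a + 1))) =
        2 * Module.finrank K (E (β - (a + 1) + 1)) := by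
      rw [hE _ hlt.le, hE _ hlt, Nat.pow_div hlt.le two_pos, Nat.pow_div hlt two_pos, ← pow_succ']
      congr 1
      omega
    rw [IntermediateField.toSubmodule_eq_sup_map_of_finrank_eq_two_mul hbi hdeg, hsub,
      ← ih (by omega), Submodule.map_span, ← Submodule.span_union]
    congr 1
    ext z
    simp only [Set.mem_image, Set.mem_Iio, Set.mem_union, exists_exists_and_eq_and,
      LinearMap.mulLeft_apply, ← hw]
    -- The monomials with index in `[2 ^ a, 2 ^ (a + 1))` are the newly adjoined generator times the
    -- earlier ones.
    have key : ∀ s < 2 ^ a, towerMonomial b (2 ^ a + s) =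
        towerMonomial b (2 ^ a) * towerMonomial b s := fun s hs => by
      simpa using towerMonomial_two_pow_mul_add b 1 hs
    constructor
    · rintro ⟨r, hr, rfl⟩
      rcases lt_or_ge r (2 ^ a) with h | h
      · exact Or.inl ⟨r, h, rfl⟩
      · obtain ⟨s, rfl⟩ := Nat.exists_eq_add_of_le h
        have hs : s < 2 ^ a := by rw [pow_succ] at hr; omega
        exact Or.inr ⟨s, hs, (key s hs).symm⟩
    · rintro (⟨r, hr, rfl⟩ | ⟨s, hs, rfl⟩)
      · exact ⟨r, by rw [pow_succ]; omega, rfl⟩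
      · exact ⟨2 ^ a + s, by rw [pow_succ]; omega, key s hs⟩

theorem exists_basis_towerMonomial {K L : Type*} [Field K] [Field L] [Algebra K L] {β : ℕ}
    (hL : Module.finrank K L = 2 ^ β) {b : Fin β → L} (hb : IsTowerGenerating K β b) :
    ∃ ω : Module.Basis (Fin (2 ^ β)) K L, ∀ r, ω r = towerMonomial b r := by
  have : FiniteDimensional K L :=
    Module.finite_of_finrank_pos (hL ▸ Nat.two_pow_pos β)
  obtain ⟨E, hE, hb⟩ := hb
  have htop : E 0 = ⊤ := by
    apply IntermediateField.toSubalgebra_injective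
    apply Subalgebra.toSubmodule_injective
    rw [IntermediateField.top_toSubalgebra, Algebra.top_toSubmodule]
    apply Submodule.eq_top_of_finrank_eq
    have := hE 0 (Nat.zero_le β)
    rw [pow_zero, Nat.div_one] at this
    exact this.trans hL.symm
  have hspan := span_towerMonomial_eq hE hb le_rfl
  rw [Nat.sub_self, htop, IntermediateField.top_toSubalgebra, Algebra.top_toSubmodule] at hspan
  refine ⟨basisOfTopLeSpanOfCardEqFinrank (fun r : Fin (2 ^ β) => towerMonomial b r) ?_
    (by rw [Fintype.card_fin, hL]),
    fun r => congrFun (coe_basisOfTopLeSpanOfCardEqFinrank _ _ _) r⟩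
  rw [← hspan]
  refine Submodule.span_mono ?_
  rintro _ ⟨r, hr, rfl⟩
  exact ⟨⟨r, hr⟩, rfl⟩

/-! ### Independence of the erased spaces -/

theorem sum_towerMonomial_mul_pow_eq_mul {L : Type*} [Field L] {β : ℕ}
    (b : Fin β → L) (x : L) (a H : ℕ) :
    ∑ r ∈ Finset.range (2 ^ a * H), towerMonomial b r * x ^ r =
      (∑ h ∈ Finset.range H, towerMonomial b (2 ^ a * h) * (x ^ 2 ^ a) ^ h) *
        ∑ s ∈ Finset.range (2 ^ a), towerMonomial b s * x ^ s := by
  rw [sum_range_mul_eq_sum_sum, Finset.sum_mul_sum]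
  refine Finset.sum_congr rfl fun h _ => Finset.sum_congr rfl fun s hs => ?_
  rw [towerMonomial_two_pow_mul_add b h (Finset.mem_range.mp hs), pow_add, pow_mul]
  ring

/-- The coordinate at the monomial `1` is `x ^ 0 = 1`. -/
theorem sum_towerMonomial_mul_pow_ne_zero {K L : Type*} [Field K] [Field L] [Algebra K L] {β : ℕ}
    {b : Fin β → L} (ω : Module.Basis (Fin (2 ^ β)) K L) (hω : ∀ r, ω r = towerMonomial b r)
    (x : K) {N : ℕ} (hN : 0 < N) (hNβ : N ≤ 2 ^ β) :
    ∑ s ∈ Finset.range N, towerMonomial b s * algebraMap K L x ^ s ≠ 0 := by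
  intro h0
  have h1 := congrArg (fun z => ω.repr z ⟨0, Nat.two_pow_pos β⟩) h0
  simp only [map_sum, map_zero, Finsupp.coe_zero, Pi.zero_apply, Finsupp.coe_finsetSum,
    Finset.sum_apply] at h1
  rw [Finset.sum_eq_single_of_mem 0 (Finset.mem_range.mpr hN)] at h1
  · have := hω ⟨0, Nat.two_pow_pos β⟩
    simp only at this
    rw [pow_zero, mul_one, ← this, ω.repr_self, Finsupp.single_eq_same] at h1
    exact one_ne_zero h1
  · intro s hs hs0
    have hsβ : s < 2 ^ β := (Finset.mem_range.mp hs).trans_le hNβ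
    have := hω ⟨s, hsβ⟩
    simp only at this
    rw [← this, ← map_pow, mul_comm, ← Algebra.smul_def, map_smul, ω.repr_self,
      Finsupp.smul_apply, Finsupp.single_eq_of_ne (by simpa [Fin.ext_iff] using hs0.symm),
      smul_zero]

theorem mem_span_towerMonomial_iff {K L : Type*} [Field K] [Field L] [Algebra K L] {β : ℕ}
    (b : Fin β → L) (N : ℕ) (z : L) :
    z ∈ Submodule.span K (towerMonomial b '' Set.Iio N) ↔
      ∃ e : ℕ → K, z = ∑ s ∈ Finset.range N, e s • towerMonomial b s := by
  constructor
  · intro hz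
    rw [← Finset.coe_range] at hz
    obtain ⟨e, he⟩ := (Submodule.mem_span_image_finset_iff_exists_fun K).mp hz
    refine ⟨fun s => if h : s ∈ Finset.range N then e ⟨s, h⟩ else 0, ?_⟩
    refine he.symm.trans (Eq.trans ?_ (Finset.sum_coe_sort (Finset.range N) _))
    exact Finset.sum_congr rfl fun s _ => by simp only [dif_pos s.2]
  · rintro ⟨e, rfl⟩
    exact Submodule.sum_mem _ fun s hs => Submodule.smul_mem _ _
      (Submodule.subset_span ⟨s, Finset.mem_range.mp hs, rfl⟩)

open Polynomial in
/-- The spaces spanned by the first `2 ^ a j` monomials, times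
`∑ h, towerMonomial b (2 ^ a j * h) * y j ^ h`, are independent if the polynomials
`X ^ 2 ^ a j - y j` are pairwise coprime and their degrees add up to `2 ^ β`. -/
theorem eq_zero_of_sum_towerMonomial_mul_eq_zero {K L ι : Type*} [Field K] [Field L] [Algebra K L]
    [DecidableEq ι] {β : ℕ} {b : Fin β → L} (ω : Module.Basis (Fin (2 ^ β)) K L)
    (hω : ∀ r, ω r = towerMonomial b r) (J : Finset ι) (a H : ι → ℕ) (y : ι → K)
    (hH : ∀ j ∈ J, 2 ^ a j * H j = 2 ^ β) (hsum : ∑ j ∈ J, 2 ^ a j = 2 ^ β)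
    (hco : ∀ i ∈ J, ∀ j ∈ J, i ≠ j →
      IsCoprime (X ^ 2 ^ a i - C (y i) : K[X]) (X ^ 2 ^ a j - C (y j)))
    (d : ι → L)
    (hd : ∀ j ∈ J, d j ∈ Submodule.span K (towerMonomial b '' Set.Iio (2 ^ a j)))
    (h0 : ∑ j ∈ J, (∑ h ∈ Finset.range (H j),
      towerMonomial b (2 ^ a j * h) * algebraMap K L (y j) ^ h) * d j = 0) :
    ∀ j ∈ J, d j = 0 := by
  simp only [mem_span_towerMonomial_iff] at hd
  choose! e he using hd
  intro i hi
  rw [he i hi]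
  refine Finset.sum_eq_zero fun s₀ hs₀ => ?_
  obtain ⟨f, hf⟩ := exists_dual_polynomial J (fun j => 2 ^ a j) y hco hi (Finset.mem_range.mp hs₀)
  rw [hsum] at hf
  -- The functional dual to the pair `(i, s₀)`: it sends the whole sum to the single coefficient `e
  -- i s₀`.
  let φ : L →ₗ[K] K := ω.constr K fun r => f.coeff r
  have hφ : ∀ r < 2 ^ β, φ (towerMonomial b r) = f.coeff r := fun r hr => by
    have h1 : φ (ω ⟨r, hr⟩) = f.coeff r := ω.constr_basis K _ _
    rwa [hω] at h1
  have hterm : ∀ j ∈ J, φ ((∑ h ∈ Finset.range (H j),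
      towerMonomial b (2 ^ a j * h) * algebraMap K L (y j) ^ h) * d j) =
      if j = i then e i s₀ else 0 := by
    intro j hj
    have h1 : (∑ h ∈ Finset.range (H j),
        towerMonomial b (2 ^ a j * h) * algebraMap K L (y j) ^ h) * d j =
        ∑ s ∈ Finset.range (2 ^ a j), e j s • ∑ h ∈ Finset.range (H j),
          y j ^ h • towerMonomial b (2 ^ a j * h + s) := by
      rw [he j hj, Finset.mul_sum]
      refine Finset.sum_congr rfl fun s hs => ?_
      rw [mul_smul_comm, Finset.sum_mul]
      congr 1
      refine Finset.sum_congr rfl fun h _ => ?_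
      rw [towerMonomial_two_pow_mul_add b h (Finset.mem_range.mp hs), Algebra.smul_def, map_pow]
      ring
    have h2 : ∀ s ∈ Finset.range (2 ^ a j), φ (e j s • ∑ h ∈ Finset.range (H j),
        y j ^ h • towerMonomial b (2 ^ a j * h + s)) =
        e j s * if j = i ∧ s = s₀ then 1 else 0 := by
      intro s hs
      have hs := Finset.mem_range.mp hs
      rw [map_smul, smul_eq_mul, ← hf j hj s hs (H j) (hH j hj), map_sum]
      congr 1
      refine Finset.sum_congr rfl fun h hh => ?_
      have hh := Finset.mem_range.mp hh
      have hlt : 2 ^ a j * h + s < 2 ^ β := by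
        rw [← hH j hj]
        calc 2 ^ a j * h + s < 2 ^ a j * h + 2 ^ a j := by omega
          _ = 2 ^ a j * (h + 1) := by ring
          _ ≤ _ := Nat.mul_le_mul_left _ hh
      rw [map_smul, hφ _ hlt, smul_eq_mul]
    rw [h1, map_sum, Finset.sum_congr rfl h2]
    by_cases hji : j = i
    · subst hji
      simp [Finset.mem_range.mp hs₀]
    · simp [hji]
  have h3 := congrArg φ h0
  rw [map_sum, Finset.sum_congr rfl hterm, map_zero, Finset.sum_ite_eq' J i, if_pos hi] at h3
  rw [h3, zero_smul]

theorem mem_span_towerMonomial_of_repr_eq_zero {K L : Type*} [Field K] [Field L] [Algebra K L]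
    {β : ℕ} {b : Fin β → L} (ω : Module.Basis (Fin (2 ^ β)) K L)
    (hω : ∀ r, ω r = towerMonomial b r) (N : ℕ) {z : L}
    (hz : ∀ r : Fin (2 ^ β), N ≤ r → ω.repr z r = 0) :
    z ∈ Submodule.span K (towerMonomial b '' Set.Iio N) := by
  rw [← ω.sum_repr z]
  refine Submodule.sum_mem _ fun r _ => ?_
  rcases lt_or_ge (r : ℕ) N with h | h
  · exact Submodule.smul_mem _ _ (Submodule.subset_span ⟨r, h, (hω r).symm⟩)
  · rw [hz r h, zero_smul]
    exact Submodule.zero_mem _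

/-! ### Power erasure patterns -/

theorem sum_two_pow_sub_eq {ι : Type*} {J : Finset ι} {m : ι → ℕ} {β : ℕ}
    (hm : ∀ j ∈ J, m j ≤ β) (hsum : ∑ j ∈ J, (1 / 2 : ℚ) ^ m j = 1) :
    ∑ j ∈ J, 2 ^ (β - m j) = 2 ^ β := by
  have h : ((∑ j ∈ J, 2 ^ (β - m j) : ℕ) : ℚ) = ((2 ^ β : ℕ) : ℚ) := by
    push_cast
    rw [← mul_one ((2 : ℚ) ^ β), ← hsum, Finset.mul_sum]
    refine Finset.sum_congr rfl fun j hj => ?_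
    rw [pow_sub₀ _ two_ne_zero (hm j hj), one_div, inv_pow]
  exact_mod_cast h

/-- An exponent `0` exhausts the sum, leaving no room for a second index. So with two indices all
block lengths divide `2 ^ β / 2`. -/
theorem one_le_of_sum_half_pow_eq_one {ι : Type*} [DecidableEq ι] {J : Finset ι} {m : ι → ℕ}
    (hsum : ∑ j ∈ J, (1 / 2 : ℚ) ^ m j = 1) {i j : ι} (hi : i ∈ J) (hj : j ∈ J) (hij : i ≠ j) :
    1 ≤ m j := by
  by_contra! h
  have hle : ∑ k ∈ {i, j}, (1 / 2 : ℚ) ^ m k ≤ ∑ k ∈ J, (1 / 2 : ℚ) ^ m k :=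
    Finset.sum_le_sum_of_subset_of_nonneg (by simp [Finset.insert_subset_iff, hi, hj])
      fun k _ _ => by positivity
  have hpos : (0 : ℚ) < (1 / 2) ^ m i := by positivity
  rw [hsum, Finset.sum_pair hij, Nat.lt_one_iff.mp h, pow_zero] at hle
  linarith

theorem mainTheorem1 {K L : Type*} [Field K] [Finite K] [Field L] [Algebra K L]
    (β : ℕ) (hβ : 1 ≤ β) (hL : Module.finrank K L = 2 ^ β)
    (b : Fin β → L) (hb : IsTowerGenerating K β b)
    (hq : 2 ^ β / 2 ∣ Nat.card K - 1)
    (n : ℕ) (ν : Fin n → K) (hν : ∀ j, ν j ≠ 0)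
    (hν' : ∀ j k, j ≠ k → ν j ^ (2 ^ β / 2) ≠ ν k ^ (2 ^ β / 2)) :
    ∃ ω : Module.Basis (Fin (2 ^ β)) K L,
      (ω : Fin (2 ^ β) → L) = recursiveVector β b ∧
      IsCorrecting ω (powerErasurePatterns β n) (foldedCode β b ν) := by
  obtain ⟨ω, hω⟩ := exists_basis_towerMonomial hL hb
  refine ⟨ω, funext fun r => by rw [hω, recursiveVector_apply], ?_⟩
  rintro t ⟨-, J, m, hm, hsum, ht⟩ c hc c' hc' hcc'
  have : FiniteDimensional K L := ω.finiteDimensional_of_finite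
  obtain ⟨E, hE, hEb⟩ := hb
  have hker := (mem_foldedCode_iff b ν (c - c')).mp (Submodule.sub_mem _ hc hc')
  have hrepr : ∀ i (r : Fin (2 ^ β)), t i ≤ r → ω.repr ((c - c') i) r = 0 := fun i r hr => by
    rw [Pi.sub_apply, map_sub, Finsupp.sub_apply, hcc' i r hr, sub_self]
  rw [← sub_eq_zero]
  set D := c - c' with hD
  have hout : ∀ j ∉ J, D j = 0 := fun j hj => by
    refine ω.repr.map_eq_zero_iff.mp (Finsupp.ext fun r => hrepr j r ?_)
    rw [ht, if_neg hj]
    exact Nat.zero_le _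
  rw [← Finset.sum_subset (Finset.subset_univ J)
    (fun j _ hj => by rw [hout j hj, mul_zero])] at hker
  set low : Fin n → L := fun j => ∑ s ∈ Finset.range (2 ^ (β - m j)),
    towerMonomial b s * algebraMap K L (ν j) ^ s with hlow
  have hH : ∀ j ∈ J, 2 ^ (β - m j) * 2 ^ m j = 2 ^ β := fun j hj => by
    rw [← pow_add, Nat.sub_add_cancel (hm j hj)]
  -- For `a < β` the exponent `2 ^ a` divides `2 ^ β / 2`, so equality at `2 ^ a` would propagate
  -- upwards.
  have hpow : ∀ i j, i ≠ j → ∀ a < β, ν i ^ 2 ^ a ≠ ν j ^ 2 ^ a := by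
    intro i j hij a ha h
    refine hν' i j hij ?_
    have h1 : 2 ^ β / 2 = 2 ^ a * 2 ^ (β - 1 - a) := by
      rw [← pow_add, Nat.add_sub_cancel' (by omega)]
      exact Nat.pow_div hβ two_pos
    rw [h1, pow_mul, pow_mul, h]
  have hzero := eq_zero_of_sum_towerMonomial_mul_eq_zero ω hω J (fun j => β - m j)
    (fun j => 2 ^ m j) (fun j => ν j ^ 2 ^ (β - m j)) hH (sum_two_pow_sub_eq hm hsum) ?_
    (fun j => low j * D j) ?_ ?_
  · funext j
    by_cases hj : j ∈ J
    · refine (mul_eq_zero.mp (hzero j hj)).resolve_left ?_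
      exact sum_towerMonomial_mul_pow_ne_zero ω hω (ν j) (Nat.two_pow_pos _)
        (Nat.pow_le_pow_right two_pos (Nat.sub_le _ _))
    · exact hout j hj
  · intro i hi j hj hij
    have hmi := one_le_of_sum_half_pow_eq_one hsum hj hi hij.symm
    have hmj := one_le_of_sum_half_pow_eq_one hsum hi hj hij
    rcases le_total (β - m i) (β - m j) with h | h
    · exact isCoprime_X_pow_sub_C_pow (pow_dvd_pow 2 h) (hpow i j hij _ (by omega))
    · exact (isCoprime_X_pow_sub_C_pow (pow_dvd_pow 2 h)
        (hpow j i hij.symm _ (by omega))).symm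
  · intro j hj
    have hDj := mem_span_towerMonomial_of_repr_eq_zero ω hω (2 ^ (β - m j)) fun r hr =>
      hrepr j r (by rw [ht, if_pos hj, Nat.pow_div (hm j hj) two_pos]; exact hr)
    have hlj : low j ∈ Submodule.span K (towerMonomial b '' Set.Iio (2 ^ (β - m j))) := by
      refine (mem_span_towerMonomial_iff b _ _).mpr ⟨fun s => ν j ^ s, ?_⟩
      refine Finset.sum_congr rfl fun s _ => ?_
      rw [Algebra.smul_def, map_pow, mul_comm]
    -- Both factors lie in a subfield of the tower, which is closed under multiplication; a mere
    -- span of basis vectors need not be.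
    rw [span_towerMonomial_eq hE hEb (Nat.sub_le β (m j))] at hDj hlj ⊢
    exact (E _).mul_mem hlj hDj
  · rw [← hker]
    refine Finset.sum_congr rfl fun j hj => ?_
    rw [← hH j hj, sum_towerMonomial_mul_pow_eq_mul, map_pow, mul_assoc]
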